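/- Let $(\tilde B,\tilde\nabla=\nabla^{\tilde g}+\mathbb K,\tilde g,J)$ be a holomorphic statistical manifold of dimension $2s$: $(\tilde g,J)$ is a Kähler structure with Levi-Civita connection $\nabla^{\tilde g}$, $\tilde\nabla$ is a torsion-free affine connection such that $\tilde\nabla\tilde g$ is totally symmetric, and the difference tensor $\mathbb K=\tilde\nabla-\nabla^{\tilde g}$ satisfies $\mathbb K(E,JF)=-J\,\mathbb K(E,F)$. Let $\overline B=\tilde B\times\mathbb R$, with coordinate $\alpha$ on $\mathbb R$, metric $\overline g=e^{2\alpha}\tilde g+(d\alpha)^2$, vector field $\xi=\partial/\partial\alpha$, and the endomorphism field $\phi$ given by $\phi E=JE$ for $E$ tangent to $\tilde B$ and $\phi\xi=0$. Let $\overline\nabla=\nabla^{\overline g}+\overline{\mathbb K}$ be an affine connection such that $(\overline\nabla,\overline g,\phi,\xi)$ is a Kenmotsu statistical structure on $\overline B$: $(\overline g,\phi,\xi)$ is a Kenmotsu structure, $\overline\nabla$ is torsion-free, $\overline\nabla\,\overline g$ is totally symmetric, and $\overline{\mathbb K}(E,\phi F)=-\phi\,\overline{\mathbb K}(E,F)$.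 For a statistical structure with connection $\nabla=\nabla^g+K$, let $S(E,F)G=R^g(E,F)G+[K_E,K_F]G$ be its statistical curvature tensor, where $R^g$ is the Riemannian curvature tensor of $\nabla^g$ and $K_EF=K(E,F)$, and let its Ricci tensor be $\mathrm{Ric}(F,G)=\mathrm{tr}\,(E\mapsto S(E,F)G)$; it is Ricci-flat if $\mathrm{Ric}=0$. Suppose that $\overline B$ has constant $\phi$-sectional curvature $\overline c\in\mathbb R$, that is, for all tangent vectors $E,F,G$ at any point of $\overline B$, the statistical curvature tensor of $\overline B$ satisfies $$\begin{aligned}\overline S(E,F)G={}&\tfrac{\overline c-3}{4}\{\overline g(F,G)E-\overline g(E,G)F\}+\tfrac{\overline c+1}{4}\{\overline g(\phi F,G)\phi E-\overline g(\phi E,G)\phi F-2\overline g(\phi E,F)\phi G\\&-\overline g(F,\xi)\overline g(G,\xi)E+\overline g(E,\xi)\overline g(G,\xi)F+\overline g(F,\xi)\overline g(G,E)\xi-\overline g(E,\xi)\overline g(G,F)\xi\}.\end{aligned}$$ Let $\alpha\in\mathbb R$ be any number such that, along the slice $\tilde B\times\{\alpha\}$, the component of $\overline{\mathbb K}(E,F)$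 tangent to $\tilde B$ equals $\mathbb K(E,F)$ for all $E,F$ tangent to $\tilde B$. Then the Ricci tensor of the statistical manifold $(\tilde B,\tilde\nabla,\tilde g)$ is $$\widetilde{\mathrm{Ric}}=e^{2\alpha}\,\frac{(\overline c+1)(s+1)}{2}\,\tilde g .$$ Furthermore, if $\overline c=-1$, then $(\tilde B,\tilde\nabla,\tilde g)$ is Ricci-flat. -/

import Mathlib

open scoped Manifold ContDiff Bundle
open ContinuousLinearMap (fst snd inl)

noncomputable section

namespace KenmotsuStat

section General

variable {E : Type*} [NormedAddCommGroup E] [NormedSpace ℝ E]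
  {H : Type*} [TopologicalSpace H] {I : ModelWithCorners ℝ E H}
  {M : Type*} [TopologicalSpace M] [ChartedSpace H M]

variable (I M) in
/-- Affine connections on `M`: `D Y x u` is the vector `(∇_u Y)(x)`, for `u` in `T_x M`. -/
abbrev AffineConnection [IsManifold I ∞ M] :=
  CovariantDerivative I E (TangentSpace I : M → Type _)

variable (I M) in
/-- Fields of bilinear forms on the tangent spaces. -/
abbrev BilinField := Π x : M, TangentSpace I x →L[ℝ] TangentSpace I x →L[ℝ] ℝ

variable (I M) in
/-- Fields of endomorphisms of the tangent spaces. -/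
abbrev EndField := Π x : M, TangentSpace I x →L[ℝ] TangentSpace I x

/-- `g` is a smooth Riemannian metric. -/
def IsRiemannianMetric [IsManifold I ∞ M] (g : BilinField I M) : Prop :=
  ∃ g' : Bundle.ContMDiffRiemannianMetric I ∞ E (TangentSpace I : M → Type _), g'.inner = g

/-- A field of endomorphisms of the tangent spaces is a smooth (1,1)-tensor field. -/
def IsSmoothEndField [IsManifold I ∞ M] (A : EndField I M) : Prop :=
  ContMDiff I (I.prod 𝓘(ℝ, E →L[ℝ] E)) ∞
    (fun x ↦ Bundle.TotalSpace.mk' (E →L[ℝ] E)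
      (E := fun x : M ↦ TangentSpace I x →L[ℝ] TangentSpace I x) x (A x))

/-- `(∇_u g)(Y, Z) = u g(Y, Z) - g(∇_u Y, Z) - g(Y, ∇_u Z)` for `u` in `T_x M`. -/
def derivMetric [IsManifold I ∞ M] (g : BilinField I M) (D : AffineConnection I M)
    (Y Z : Π x : M, TangentSpace I x) (x : M) (u : TangentSpace I x) : ℝ :=
  d% (fun y ↦ g y (Y y) (Z y)) x u - g x (D Y x u) (Z x) - g x (Y x) (D Z x u)

/-- The Riemannian curvature tensor
`R(u, v) w = ∇_X ∇_Y Z - ∇_Y ∇_X Z - ∇_[X, Y] Z` at `x`, where `X`, `Y`, `Z` are vector fields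
extending `u`, `v`, `w`, smooth near `x`. -/
def curvature [IsManifold I ∞ M] (D : AffineConnection I M) (x : M)
    (u v w : TangentSpace I x) : TangentSpace I x :=
  let X : Π y : M, TangentSpace I y := FiberBundle.extend E u
  let Y : Π y : M, TangentSpace I y := FiberBundle.extend E v
  let Z : Π y : M, TangentSpace I y := FiberBundle.extend E w
  D (fun y ↦ D Z y (Y y)) x u - D (fun y ↦ D Z y (X y)) x v
    - D Z x (VectorField.mlieBracket I X Y x)

variable [FiniteDimensional ℝ E] [IsManifold I ∞ M]

/-- `D` is the Levi-Civita connection of `g`. -/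
structure IsLeviCivita (g : BilinField I M) (D : AffineConnection I M) : Prop where
  smooth : D.ContMDiffCovariantDerivative ∞
  torsion_free : D.torsion = 0
  metric : ∀ (x : M) (Y Z : Π x : M, TangentSpace I x), MDiffAt (T% Y) x → MDiffAt (T% Z) x →
    ∀ u : TangentSpace I x, derivMetric g D Y Z x u = 0

/-- `(D, g)` is a statistical structure: `D` is torsion-free and `∇g` is totally symmetric. -/
structure IsStatistical (g : BilinField I M) (D : AffineConnection I M) : Prop where
  smooth : D.ContMDiffCovariantDerivative ∞
  torsion_free : D.torsion = 0
  codazzi : ∀ (x : M) (X Y Z : Π x : M, TangentSpace I x),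
    MDiffAt (T% X) x → MDiffAt (T% Y) x → MDiffAt (T% Z) x →
    derivMetric g D Y Z x (X x) = derivMetric g D X Z x (Y x)

/-- The difference tensor `K(u, v) = ∇_u V - ∇⁰_u V` of two connections `D = ∇`, `D₀ = ∇⁰`,
where `V` is any vector field extending `v`. -/
def diffTensor (D D₀ : AffineConnection I M) (x : M) (u v : TangentSpace I x) :
    TangentSpace I x :=
  D.difference D₀ x v u

/-- The statistical curvature tensor `S(u, v) w = R⁰(u, v) w + [K_u, K_v] w` of the statistical
structure with connection `D = D₀ + K`, where `D₀` is the Levi-Civita connection and `R⁰` its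
curvature. -/
def statCurvature (D D₀ : AffineConnection I M) (x : M) (u v w : TangentSpace I x) :
    TangentSpace I x :=
  curvature D₀ x u v w + diffTensor D D₀ x u (diffTensor D D₀ x v w)
    - diffTensor D D₀ x v (diffTensor D D₀ x u w)

/-- The Ricci tensor `Ric(v, w) = tr (u ↦ S(u, v) w)` of the statistical structure with connection
`D` and Levi-Civita connection `D₀`; the trace is computed in a basis of the tangent space. -/
def ricci (D D₀ : AffineConnection I M) (x : M) (v w : TangentSpace I x) : ℝ :=
  let b : Module.Basis (Fin (Module.finrank ℝ E)) ℝ (TangentSpace I x) := Module.finBasis ℝ E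
  ∑ i, b.repr (statCurvature D D₀ x (b i) v w) i

/-- The Ricci tensor of the statistical structure vanishes. -/
def IsRicciFlat (D D₀ : AffineConnection I M) : Prop :=
  ∀ (x : M) (v w : TangentSpace I x), ricci D D₀ x v w = 0

/-- `(g, J)` is a Kähler structure; `D₀` is the Levi-Civita connection of `g`. -/
structure IsKaehler (g : BilinField I M) (D₀ : AffineConnection I M) (J : EndField I M) :
    Prop where
  riemannian : IsRiemannianMetric g
  levi_civita : IsLeviCivita g D₀
  smooth : IsSmoothEndField J
  sq : ∀ (x : M) (u : TangentSpace I x), J x (J x u) = -u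
  hermitian : ∀ (x : M) (u v : TangentSpace I x), g x (J x u) (J x v) = g x u v
  /-- `∇⁰ J = 0` -/
  parallel : ∀ (x : M) (Y : Π x : M, TangentSpace I x), MDiffAt (T% Y) x →
    ∀ u : TangentSpace I x, D₀ (fun y ↦ J y (Y y)) x u = J x (D₀ Y x u)

/-- `(D, g, J)` is a holomorphic statistical structure; `D₀` is the Levi-Civita connection
of `g`. -/
structure IsHolomorphicStatistical (g : BilinField I M) (D D₀ : AffineConnection I M)
    (J : EndField I M) : Prop where
  kaehler : IsKaehler g D₀ J
  statistical : IsStatistical g D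
  anti : ∀ (x : M) (u v : TangentSpace I x),
    diffTensor D D₀ x u (J x v) = -J x (diffTensor D D₀ x u v)

/-- `(g, φ, ξ)` is a Kenmotsu structure: an almost contact metric structure, with
`η = g(·, ξ)`, satisfying `(∇⁰_u φ) Y = g(φ u, Y) ξ - η(Y) φ u` and `∇⁰_u ξ = u - η(u) ξ`;
`D₀ = ∇⁰` is the Levi-Civita connection of `g`. -/
structure IsKenmotsu (g : BilinField I M) (D₀ : AffineConnection I M) (φ : EndField I M)
    (ξ : Π x : M, TangentSpace I x) : Prop where
  riemannian : IsRiemannianMetric g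
  levi_civita : IsLeviCivita g D₀
  smooth_phi : IsSmoothEndField φ
  smooth_xi : CMDiff ∞ (T% ξ)
  unit : ∀ x : M, g x (ξ x) (ξ x) = 1
  phi_xi : ∀ x : M, φ x (ξ x) = 0
  phi_sq : ∀ (x : M) (u : TangentSpace I x), φ x (φ x u) = -u + g x u (ξ x) • ξ x
  compatible : ∀ (x : M) (u v : TangentSpace I x),
    g x (φ x u) (φ x v) = g x u v - g x u (ξ x) * g x v (ξ x)
  deriv_phi : ∀ (x : M) (Y : Π x : M, TangentSpace I x), MDiffAt (T% Y) x →
    ∀ u : TangentSpace I x, D₀ (fun y ↦ φ y (Y y)) x u - φ x (D₀ Y x u) =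
      g x (φ x u) (Y x) • ξ x - g x (Y x) (ξ x) • φ x u
  deriv_xi : ∀ (x : M) (u : TangentSpace I x), D₀ ξ x u = u - g x u (ξ x) • ξ x

/-- `(D, g, φ, ξ)` is a Kenmotsu statistical structure; `D₀` is the Levi-Civita connection
of `g`. -/
structure IsKenmotsuStatistical (g : BilinField I M) (D D₀ : AffineConnection I M)
    (φ : EndField I M) (ξ : Π x : M, TangentSpace I x) : Prop where
  kenmotsu : IsKenmotsu g D₀ φ ξ
  statistical : IsStatistical g D
  anti : ∀ (x : M) (u v : TangentSpace I x),
    diffTensor D D₀ x u (φ x v) = -φ x (diffTensor D D₀ x u v)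

/-- The Kenmotsu statistical structure `(D, g, φ, ξ)`, with Levi-Civita connection `D₀`, has
constant `φ`-sectional curvature `c`. -/
def HasConstantPhiCurvature (g : BilinField I M) (D D₀ : AffineConnection I M)
    (φ : EndField I M) (ξ : Π x : M, TangentSpace I x) (c : ℝ) : Prop :=
  ∀ (x : M) (u v w : TangentSpace I x),
    statCurvature D D₀ x u v w =
      ((c - 3) / 4) • (g x v w • u - g x u w • v)
      + ((c + 1) / 4) • (g x (φ x v) w • φ x u - g x (φ x u) w • φ x v
          - (2 * g x (φ x u) v) • φ x w
          - (g x v (ξ x) * g x w (ξ x)) • u + (g x u (ξ x) * g x w (ξ x)) • v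
          + (g x v (ξ x) * g x w u) • ξ x - (g x u (ξ x) * g x w v) • ξ x)

end General

/-! ### The warped product `M × ℝ` with metric `e^{2α} g + (dα)²`

The tangent space of `M × ℝ` at `(x, α)` is `T_x M × ℝ`; the coordinate `α` of a point `p` is
`p.2`. -/

section Warped

variable {E : Type*} [NormedAddCommGroup E] [NormedSpace ℝ E]
  {H : Type*} [TopologicalSpace H] {I : ModelWithCorners ℝ E H}
  {M : Type*} [TopologicalSpace M] [ChartedSpace H M]

/-- The metric `e^{2α} g + (dα)²`. -/
def warpedMetric (g : BilinField I M) : BilinField (I.prod 𝓘(ℝ, ℝ)) (M × ℝ) := fun p ↦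
  let gp : E →L[ℝ] E →L[ℝ] ℝ := g p.1
  (Real.exp (2 * p.2) • gp.bilinearComp (fst ℝ E ℝ) (fst ℝ E ℝ)
    + (ContinuousLinearMap.mul ℝ ℝ).bilinearComp (snd ℝ E ℝ) (snd ℝ E ℝ) :
      (E × ℝ) →L[ℝ] (E × ℝ) →L[ℝ] ℝ)

/-- The endomorphism field with `φ u = J u` for `u` tangent to `M`, and `φ (∂/∂α) = 0`. -/
def warpedPhi (J : EndField I M) : EndField (I.prod 𝓘(ℝ, ℝ)) (M × ℝ) := fun p ↦
  let Jp : E →L[ℝ] E := J p.1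
  ((inl ℝ E ℝ).comp (Jp.comp (fst ℝ E ℝ)) : (E × ℝ) →L[ℝ] (E × ℝ))

variable (I M) in
/-- The vector field `ξ = ∂/∂α`. -/
def warpedXi : Π p : M × ℝ, TangentSpace (I.prod 𝓘(ℝ, ℝ)) p := fun _ ↦ ((0, 1) : E × ℝ)

/-- A vector `u` tangent to `M` at `x`, as a vector tangent to `M × ℝ` at `(x, α)`. -/
def lift (x : M) (α : ℝ) (u : TangentSpace I x) : TangentSpace (I.prod 𝓘(ℝ, ℝ)) (x, α) :=
  ((u, 0) : E × ℝ)

/-- The component tangent to `M` of a vector tangent to `M × ℝ` at `(x, α)`. -/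
def tangentPart (x : M) (α : ℝ) (w : TangentSpace (I.prod 𝓘(ℝ, ℝ)) (x, α)) : TangentSpace I x :=
  Prod.fst (α := E) (β := ℝ) w

theorem warpedMetric_apply (g : BilinField I M) (x : M) (α : ℝ) (u v : TangentSpace I x)
    (a b : ℝ) : warpedMetric g (x, α) ((u, a) : E × ℝ) ((v, b) : E × ℝ) =
      Real.exp (2 * α) * g x u v + a * b := rfl

theorem warpedPhi_apply (J : EndField I M) (x : M) (α : ℝ) (u : TangentSpace I x) (a : ℝ) :
    warpedPhi J (x, α) ((u, a) : E × ℝ) = ((J x u, 0) : E × ℝ) := rfl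

end Warped

end KenmotsuStat

end

noncomputable section

namespace KenmotsuStat

section LiftField

open Set

variable {E : Type*} [NormedAddCommGroup E] [NormedSpace ℝ E]
  {H : Type*} [TopologicalSpace H] {I : ModelWithCorners ℝ E H}
  {M : Type*} [TopologicalSpace M] [ChartedSpace H M]

/-- The horizontal lift to `M × ℝ` of a vector field on `M`. -/
def liftField (Y : Π x : M, TangentSpace I x) :
    Π p : M × ℝ, TangentSpace (I.prod 𝓘(ℝ, ℝ)) p :=
  fun p ↦ lift p.1 p.2 (Y p.1)

theorem mvfderiv_comp_lift {f : M × ℝ → ℝ} {x : M} {α : ℝ} (hf : MDiffAt f (x, α))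
    (u : TangentSpace I x) :
    mvfderiv (I.prod 𝓘(ℝ, ℝ)) f (x, α) (lift x α u) = mvfderiv I (fun y ↦ f (y, α)) x u := by
  have h1 : MDifferentiableAt I (I.prod 𝓘(ℝ, ℝ)) (fun y : M ↦ ((y, α) : M × ℝ)) x :=
    mdifferentiableAt_id.prodMk mdifferentiableAt_const
  have h2 := mvfderiv_comp_apply (g := f) (f := fun y : M ↦ ((y, α) : M × ℝ)) x hf h1 u
  have h3 := congrArg (fun A : E →L[ℝ] E × ℝ ↦ A u)
    (mfderiv_prod_left (I := I) (I' := 𝓘(ℝ, ℝ)) (x₀ := x) (y₀ := α))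
  refine Eq.trans ?_ h2.symm
  exact congrArg (mvfderiv (I.prod 𝓘(ℝ, ℝ)) f (x, α) : E × ℝ →L[ℝ] ℝ) h3.symm

theorem mdifferentiableAt_liftField [IsManifold I ∞ M] {Y : Π x : M, TangentSpace I x}
    {p : M × ℝ} (hY : MDiffAt (T% Y) p.1) : MDiffAt (T% (liftField Y)) p := by
  have h1 : MDifferentiableAt (I.prod 𝓘(ℝ, ℝ)) I.tangent
      (fun q : M × ℝ ↦ (⟨q.1, Y q.1⟩ : TangentBundle I M)) p :=
    MDifferentiableAt.comp p hY mdifferentiableAt_fst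
  have h2 : MDifferentiableAt (I.prod 𝓘(ℝ, ℝ)) 𝓘(ℝ, ℝ).tangent
      (fun q : M × ℝ ↦ (⟨q.2, 0⟩ : TangentBundle 𝓘(ℝ, ℝ) ℝ)) p :=
    MDifferentiableAt.comp (g := fun t : ℝ ↦ (⟨t, 0⟩ : TangentBundle 𝓘(ℝ, ℝ) ℝ)) p
      (Bundle.mdifferentiable_zeroSection ℝ (TangentSpace 𝓘(ℝ, ℝ) : ℝ → Type _) p.2)
      mdifferentiableAt_snd
  have h3 := (contMDiff_equivTangentBundleProd_symm (n := 1) (I := I) (M := M) (I' := 𝓘(ℝ, ℝ))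
    (M' := ℝ)).mdifferentiable one_ne_zero
  exact (h3 _).comp p (h1.prodMk h2)

theorem extend_eq_tangentCoordChange [IsManifold I 1 M] {x y : M}
    (hy : y ∈ (chartAt H x).source) (u : TangentSpace I x) :
    (FiberBundle.extend E u : Π y : M, TangentSpace I y) y = tangentCoordChange I x y y u := by
  have h0 : (trivializationAt E (TangentSpace I) x ⟨x, u⟩).2 = u :=
    tangentCoordChange_self (I := I) (mem_extChartAt_source x)
  have h1 := congrArg (fun A : E →L[ℝ] E ↦ A u) (TangentBundle.symmL_trivializationAt_eq_core
    (𝕜 := ℝ) (I := I) hy)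
  unfold FiberBundle.extend
  rw [h0]
  refine Eq.trans ?_ h1
  exact (Bundle.Trivialization.symmL_apply (R := ℝ) _ (b := y) hy _).symm

theorem _root_.HasFDerivWithinAt.prodMap_id {E F : Type*} [NormedAddCommGroup E] [NormedSpace ℝ E]
    [NormedAddCommGroup F] [NormedSpace ℝ F] {f : E → F} {A : E →L[ℝ] F} {s : Set E} {a : E}
    (h : HasFDerivWithinAt f A s a) (β : ℝ) :
    HasFDerivWithinAt (Prod.map f (id : ℝ → ℝ)) (A.prodMap (ContinuousLinearMap.id ℝ ℝ))
      (s ×ˢ univ) (a, β) :=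
  HasFDerivWithinAt.prodMap (p := (a, β))
    (h.mono (image_subset_iff.2 fun _ hq ↦ hq.1)) (hasFDerivWithinAt_id β _)

theorem tangentCoordChange_prod [IsManifold I 1 M] {x y : M} (hy : y ∈ (chartAt H x).source)
    (α β : ℝ) (u : E) :
    tangentCoordChange (I.prod 𝓘(ℝ, ℝ)) (x, α) (y, β) (y, β) ((u, 0) : E × ℝ) =
      ((tangentCoordChange I x y y u, 0) : E × ℝ) := by
  have h1 := hasFDerivWithinAt_tangentCoordChange (I := I) (x := x) (y := y) (z := y)
    ⟨by simpa using hy, by simp⟩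
  have h4 := (h1.prodMap_id β).fderivWithin (I.uniqueDiffOn.prod uniqueDiffOn_univ _
    ⟨mem_range_self _, mem_univ _⟩)
  have h5 : (extChartAt (I.prod 𝓘(ℝ, ℝ)) ((y, β) : M × ℝ) ∘
      (extChartAt (I.prod 𝓘(ℝ, ℝ)) ((x, α) : M × ℝ)).symm) =
      Prod.map (extChartAt I y ∘ (extChartAt I x).symm) (id : ℝ → ℝ) := by
    rw [extChartAt_prod, extChartAt_prod, extChartAt_model_space_eq_id, extChartAt_model_space_eq_id]
    rfl
  have h6 : extChartAt (I.prod 𝓘(ℝ, ℝ)) ((x, α) : M × ℝ) (y, β) = (extChartAt I x y, β) := by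
    rw [extChartAt_prod, extChartAt_model_space_eq_id]
    rfl
  rw [tangentCoordChange_def, h5, h6, ModelWithCorners.range_prod, modelWithCornersSelf_coe,
    range_id, h4]
  rfl

theorem extend_lift [IsManifold I ∞ M] {x y : M} (hy : y ∈ (chartAt H x).source) (α β : ℝ)
    (u : TangentSpace I x) :
    (FiberBundle.extend (E × ℝ) (x := ((x, α) : M × ℝ)) (lift x α u) :
        Π p : M × ℝ, TangentSpace (I.prod 𝓘(ℝ, ℝ)) p) (y, β) =
      liftField (FiberBundle.extend E u) (y, β) := by
  have hp : ((y, β) : M × ℝ) ∈ (chartAt (ModelProd H ℝ) ((x, α) : M × ℝ)).source := by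
    rw [prodChartedSpace_chartAt]
    exact ⟨hy, mem_univ _⟩
  have h1 := extend_eq_tangentCoordChange (I := I.prod 𝓘(ℝ, ℝ)) hp (lift x α u)
  have h2 := extend_eq_tangentCoordChange (I := I) hy u
  refine h1.trans ((tangentCoordChange_prod (E := E) (I := I) hy α β u).trans ?_)
  exact congrArg (lift y β) h2.symm

theorem eventually_extend_lift [IsManifold I ∞ M] (x : M) (α : ℝ) (u : TangentSpace I x) :
    ∀ᶠ p in nhds (x, α), (FiberBundle.extend (E × ℝ) (x := ((x, α) : M × ℝ)) (lift x α u) :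
        Π p : M × ℝ, TangentSpace (I.prod 𝓘(ℝ, ℝ)) p) p =
      liftField (FiberBundle.extend E u) p := by
  have h : ∀ᶠ p : M × ℝ in nhds (x, α), p.1 ∈ (chartAt H x).source :=
    continuous_fst.continuousAt ((chartAt H x).open_source.mem_nhds (mem_chart_source H x))
  filter_upwards [h] with p hp
  exact extend_lift hp α p.2 u

end LiftField

section LieBracket

open Set VectorField

theorem _root_.ContinuousLinearMap.IsInvertible.prodMap_id_inverse_apply {V W : Type*}
    [TopologicalSpace V] [AddCommGroup V] [Module ℝ V]
    [TopologicalSpace W] [AddCommGroup W] [Module ℝ W]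
    {A : V →L[ℝ] W} (hA : A.IsInvertible) (w : W) (t : ℝ) :
    (A.prodMap (ContinuousLinearMap.id ℝ ℝ)).inverse (w, t) = (A.inverse w, t) := by
  obtain ⟨e, rfl⟩ := hA
  have h : ((e : V →L[ℝ] W).prodMap (ContinuousLinearMap.id ℝ ℝ)) =
      ((e.prodCongr (ContinuousLinearEquiv.refl ℝ ℝ) : (V × ℝ) ≃L[ℝ] (W × ℝ)) :
        (V × ℝ) →L[ℝ] (W × ℝ)) := by
    ext <;> simp
  rw [h, ContinuousLinearMap.inverse_equiv, ContinuousLinearMap.inverse_equiv]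
  rfl

variable {E : Type*} [NormedAddCommGroup E] [NormedSpace ℝ E]
  {H : Type*} [TopologicalSpace H] {I : ModelWithCorners ℝ E H}
  {M : Type*} [TopologicalSpace M] [ChartedSpace H M]

theorem _root_.VectorField.lieBracketWithin_prod_zero {V W : E → E} {s : Set E} {a : E} {β : ℝ}
    (hs : UniqueDiffWithinAt ℝ s a) (hV : DifferentiableWithinAt ℝ V s a)
    (hW : DifferentiableWithinAt ℝ W s a) :
    lieBracketWithin ℝ (fun q : E × ℝ ↦ ((V q.1, 0) : E × ℝ)) (fun q ↦ (W q.1, 0))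
      (s ×ˢ univ) (a, β) = (lieBracketWithin ℝ V W s a, 0) := by
  have hu : UniqueDiffWithinAt ℝ (s ×ˢ (univ : Set ℝ)) (a, β) := hs.prod uniqueDiffWithinAt_univ
  have key : ∀ {U : E → E}, DifferentiableWithinAt ℝ U s a →
      fderivWithin ℝ (fun q : E × ℝ ↦ ((U q.1, 0) : E × ℝ)) (s ×ˢ univ) (a, β) =
        ((fderivWithin ℝ U s a).comp (fst ℝ E ℝ)).prod 0 := by
    intro U hU
    have h1 : HasFDerivWithinAt (fun q : E × ℝ ↦ U q.1) ((fderivWithin ℝ U s a).comp (fst ℝ E ℝ))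
        (s ×ˢ univ) (a, β) :=
      HasFDerivWithinAt.comp (a, β) (g := U) (f := Prod.fst) (t := s) hU.hasFDerivWithinAt
        hasFDerivWithinAt_fst (fun _ hq ↦ hq.1)
    exact (h1.prodMk (hasFDerivWithinAt_const (0 : ℝ) _ _)).fderivWithin hu
  simp [lieBracketWithin, key hV, key hW]

theorem extChartAt_prod_real (x : M) (α : ℝ) :
    (extChartAt (I.prod 𝓘(ℝ, ℝ)) ((x, α) : M × ℝ) : M × ℝ → E × ℝ) =
      Prod.map (extChartAt I x) (id : ℝ → ℝ) := by
  rw [extChartAt_prod, extChartAt_model_space_eq_id]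
  rfl

theorem extChartAt_prod_real_symm (x : M) (α : ℝ) :
    ((extChartAt (I.prod 𝓘(ℝ, ℝ)) ((x, α) : M × ℝ)).symm : E × ℝ → M × ℝ) =
      Prod.map (extChartAt I x).symm (id : ℝ → ℝ) := by
  rw [extChartAt_prod, extChartAt_model_space_eq_id]
  rfl

variable [IsManifold I ∞ M]

theorem mfderivWithin_extChartAt_prod_real_symm {x : M} (α : ℝ) {q : E × ℝ}
    (hq : q.1 ∈ (extChartAt I x).target) :
    (mfderivWithin 𝓘(ℝ, E × ℝ) (I.prod 𝓘(ℝ, ℝ)) (extChartAt (I.prod 𝓘(ℝ, ℝ)) (x, α)).symm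
      (range (I.prod 𝓘(ℝ, ℝ))) q : E × ℝ →L[ℝ] E × ℝ) =
      ContinuousLinearMap.prodMap (mfderivWithin 𝓘(ℝ, E) I (extChartAt I x).symm (range I) q.1 :
        E →L[ℝ] E) (ContinuousLinearMap.id ℝ ℝ) := by
  rw [extChartAt_prod_real_symm, ModelWithCorners.range_prod, modelWithCornersSelf_coe, range_id,
    modelWithCornersSelf_prod, ← chartedSpaceSelf_prod]
  have h := mfderivWithin_prodMap (p := q) (t := univ) (g := (id : ℝ → ℝ)) (I' := 𝓘(ℝ, ℝ))
    (J' := 𝓘(ℝ, ℝ))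
    (mdifferentiableWithinAt_extChartAt_symm (I := I) hq) mdifferentiableWithinAt_id
    (I.uniqueMDiffOn _ (extChartAt_target_subset_range x hq)) (uniqueMDiffWithinAt_univ _)
  rw [mfderivWithin_univ, mfderiv_id] at h
  exact h

theorem mfderiv_extChartAt_prod_real (x : M) (α : ℝ) :
    (mfderiv (I.prod 𝓘(ℝ, ℝ)) 𝓘(ℝ, E × ℝ) (extChartAt (I.prod 𝓘(ℝ, ℝ)) ((x, α) : M × ℝ)) (x, α) :
      E × ℝ →L[ℝ] E × ℝ) =
      ContinuousLinearMap.prodMap (mfderiv I 𝓘(ℝ, E) (extChartAt I x) x :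
        E →L[ℝ] E) (ContinuousLinearMap.id ℝ ℝ) := by
  rw [extChartAt_prod_real, modelWithCornersSelf_prod, ← chartedSpaceSelf_prod]
  have h := mfderiv_prodMap (p := (x, α)) (g := (id : ℝ → ℝ)) (I' := 𝓘(ℝ, ℝ))
    (J' := 𝓘(ℝ, ℝ))
    (mdifferentiableAt_extChartAt (I := I) (mem_chart_source H x)) mdifferentiableAt_id
  rw [mfderiv_id] at h
  exact h

theorem mpullbackWithin_liftField {x : M} (α : ℝ) (V : Π x : M, TangentSpace I x) {q : E × ℝ}
    (hq : q.1 ∈ (extChartAt I x).target) :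
    (mpullbackWithin 𝓘(ℝ, E × ℝ) (I.prod 𝓘(ℝ, ℝ)) (extChartAt (I.prod 𝓘(ℝ, ℝ)) (x, α)).symm
      (liftField V) (range (I.prod 𝓘(ℝ, ℝ))) q : E × ℝ) =
    ((mpullbackWithin 𝓘(ℝ, E) I (extChartAt I x).symm V (range I) q.1, 0) : E × ℝ) := by
  have h1 : ContinuousLinearMap.IsInvertible
      (mfderivWithin 𝓘(ℝ, E) I (extChartAt I x).symm (range I) q.1 : E →L[ℝ] E) :=
    isInvertible_mfderivWithin_extChartAt_symm (I := I) hq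
  have h2 := h1.prodMap_id_inverse_apply (V ((extChartAt I x).symm q.1)) 0
  rw [← mfderivWithin_extChartAt_prod_real_symm α hq] at h2
  have h3 := congrFun (extChartAt_prod_real_symm (I := I) x α) q
  rw [mpullbackWithin_apply, h3]
  exact h2

theorem mlieBracket_liftField [FiniteDimensional ℝ E] {V W : Π x : M, TangentSpace I x} {x : M}
    (α : ℝ) (hV : MDiffAt (T% V) x) (hW : MDiffAt (T% W) x) :
    mlieBracket (I.prod 𝓘(ℝ, ℝ)) (liftField V) (liftField W) (x, α) =
      lift x α (mlieBracket I V W x) := by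
  have : IsManifold I 2 M := IsManifold.of_le (n := ∞) (by norm_cast)
  have hdiff : ∀ {U : Π x : M, TangentSpace I x}, MDiffAt (T% U) x → DifferentiableWithinAt ℝ
      (mpullbackWithin 𝓘(ℝ, E) I (extChartAt I x).symm U (range I) : E → E) (range I)
      (extChartAt I x x) := by
    intro U hU
    have := MDifferentiableWithinAt.differentiableWithinAt_mpullbackWithin_vectorField
      (mdifferentiableWithinAt_univ.2 hU)
    simpa only [preimage_univ, univ_inter] using! this
  have hx : extChartAt (I.prod 𝓘(ℝ, ℝ)) ((x, α) : M × ℝ) (x, α) = (extChartAt I x x, α) :=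
    congrFun (extChartAt_prod_real (I := I) x α) (x, α)
  have hev : ∀ U : Π x : M, TangentSpace I x,
      (mpullbackWithin 𝓘(ℝ, E × ℝ) (I.prod 𝓘(ℝ, ℝ)) (extChartAt (I.prod 𝓘(ℝ, ℝ)) (x, α)).symm
        (liftField U) (range (I.prod 𝓘(ℝ, ℝ))) : E × ℝ → E × ℝ) =ᶠ[
          nhdsWithin (extChartAt I x x, α) (range I ×ˢ univ)]
      fun q ↦ ((mpullbackWithin 𝓘(ℝ, E) I (extChartAt I x).symm U (range I) q.1, 0) : E × ℝ) := by
    intro U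
    have h : (extChartAt I x).target ×ˢ (univ : Set ℝ) ∈
        nhdsWithin (extChartAt I x x, α) (range I ×ˢ univ) := by
      rw [nhdsWithin_prod_eq]
      exact Filter.prod_mem_prod (extChartAt_target_mem_nhdsWithin x) Filter.univ_mem
    filter_upwards [h] with q hq
    exact mpullbackWithin_liftField α U hq.1
  have hmem : ((extChartAt I x x, α) : E × ℝ) ∈ range I ×ˢ (univ : Set ℝ) :=
    ⟨mem_range_self _, mem_univ _⟩
  have hb := (hev V).lieBracketWithin_vectorField_eq_of_mem (𝕜 := ℝ) (hev W) hmem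
  have hu : UniqueDiffWithinAt ℝ (range I) (extChartAt I x x) :=
    I.uniqueDiffOn _ (mem_range_self _)
  replace hb := hb.trans (lieBracketWithin_prod_zero hu (hdiff hV) (hdiff hW))
  have h1 : ContinuousLinearMap.IsInvertible (mfderiv I 𝓘(ℝ, E) (extChartAt I x) x : E →L[ℝ] E) :=
    isInvertible_mfderiv_extChartAt (mem_extChartAt_source x)
  have h2 := ContinuousLinearMap.IsInvertible.prodMap_id_inverse_apply (V := E) (W := E) h1
    (lieBracketWithin ℝ (mpullbackWithin 𝓘(ℝ, E) I (extChartAt I x).symm V (range I) : E → E)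
      (mpullbackWithin 𝓘(ℝ, E) I (extChartAt I x).symm W (range I)) (range I) (extChartAt I x x)) 0
  have h3 := (congrArg (fun A : E × ℝ →L[ℝ] E × ℝ ↦ A.inverse _)
    (mfderiv_extChartAt_prod_real (I := I) x α)).trans h2
  have h4 := (congrArg (mfderiv (I.prod 𝓘(ℝ, ℝ)) 𝓘(ℝ, E × ℝ)
    (extChartAt (I.prod 𝓘(ℝ, ℝ)) ((x, α) : M × ℝ)) (x, α) : E × ℝ →L[ℝ] E × ℝ).inverse hb).trans h3
  rw [← mlieBracketWithin_univ, ← mlieBracketWithin_univ, mlieBracketWithin_apply,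
    mlieBracketWithin_apply, hx]
  simp only [preimage_univ, univ_inter, ModelWithCorners.range_prod, modelWithCornersSelf_coe,
    range_id] at h4 ⊢
  exact h4

end LieBracket

section Connection

open Set VectorField

variable {E : Type*} [NormedAddCommGroup E] [NormedSpace ℝ E]
  {H : Type*} [TopologicalSpace H] {I : ModelWithCorners ℝ E H}
  {M : Type*} [TopologicalSpace M] [ChartedSpace H M] [IsManifold I ∞ M]

theorem IsRiemannianMetric.symm {g : BilinField I M} (hg : IsRiemannianMetric g) (x : M)
    (u v : TangentSpace I x) : g x u v = g x v u := by
  obtain ⟨g', rfl⟩ := hg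
  exact g'.symm x u v

theorem IsRiemannianMetric.eq_zero {g : BilinField I M} (hg : IsRiemannianMetric g) {x : M}
    {u : TangentSpace I x} (h : ∀ v, g x u v = 0) : u = 0 := by
  obtain ⟨g', rfl⟩ := hg
  by_contra hu
  exact (g'.pos x u hu).ne' (h u)

theorem IsRiemannianMetric.mdifferentiableAt {g : BilinField I M} (hg : IsRiemannianMetric g)
    {x : M} {Y Z : Π x : M, TangentSpace I x} (hY : MDiffAt (T% Y) x) (hZ : MDiffAt (T% Z) x) :
    MDiffAt (fun y ↦ g y (Y y) (Z y)) x := by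
  obtain ⟨g', rfl⟩ := hg
  have h := MDifferentiableAt.clm_bundle_apply₂ (F₁ := E) (F₂ := E) (F₃ := ℝ)
    (E₃ := Bundle.Trivial M ℝ) (b := id)
    ((g'.contMDiff.mdifferentiable (by simp)).mdifferentiableAt (x := x)) hY hZ
  simp only [mdifferentiableAt_totalSpace] at h
  exact h.2

theorem mdifferentiableAt_connection [FiniteDimensional ℝ E] [T2Space M] {D : AffineConnection I M}
    (hD : D.ContMDiffCovariantDerivative ∞) {Y Z : Π x : M, TangentSpace I x} {x : M} {s : Set M}
    (hs : s ∈ nhds x) (hZ : CMDiff[s] ∞ (T% Z)) (hY : MDiffAt (T% Y) x) :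
    MDiffAt (T% (fun y ↦ D Z y (Y y))) x := by
  obtain ⟨ψ, hψ⟩ : ∃ ψ : SmoothBumpFunction I x, tsupport ψ ⊆ interior s :=
    (SmoothBumpFunction.nhds_basis_support (I := I) (interior_mem_nhds.2 hs)).ex_mem
  have h1 : CMDiff ∞ (T% ((ψ : M → ℝ) • Z)) :=
    ContMDiffOn.smul_section_of_tsupport ψ.contMDiff.contMDiffOn isOpen_interior hψ
      (hZ.mono interior_subset)
  have h2 := hD.contMDiff.contMDiff h1.contMDiffOn
  have h3 := (h2.contMDiffAt Filter.univ_mem (x := x)).mdifferentiableAt (by simp)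
  have h4 := MDifferentiableAt.clm_bundle_apply (b := id) h3 hY
  refine h4.congr_of_eventuallyEq ?_
  have h5 : ∀ᶠ y in nhds x, ∀ᶠ z in nhds y, ψ z = 1 := ψ.eventuallyEq_one.eventually_nhds
  filter_upwards [h5, mem_interior_iff_mem_nhds.1 (mem_interior_iff_mem_nhds.2
    (interior_mem_nhds.2 hs))] with y hy hys
  have hZy : MDiffAt (T% Z) y :=
    ((hZ y (interior_subset hys)).contMDiffAt (mem_interior_iff_mem_nhds.1 hys)).mdifferentiableAt
      (by simp)
  have := D.isCovariantDerivativeOn.congr_of_eventuallyEq (σ := Z) (σ' := (ψ : M → ℝ) • Z) hZy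
    ((h1 y).mdifferentiableAt (by simp)) Filter.univ_mem (hy.mono fun z hz ↦ by simp [hz])
  simp [this]

/-- A torsion-free connection compatible with `g` is determined by `g`. Here the second connection
is only given as an operation on vector fields at one point. -/
theorem IsLeviCivita.eq_of_torsion_of_metric [FiniteDimensional ℝ E] {g : BilinField I M}
    (hg : IsRiemannianMetric g) {D : AffineConnection I M} (hD : IsLeviCivita g D) {x : M}
    (P : (Π y : M, TangentSpace I y) → TangentSpace I x → TangentSpace I x)
    (htor : ∀ X Y : Π y : M, TangentSpace I y, MDiffAt (T% X) x → MDiffAt (T% Y) x →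
      P Y (X x) - P X (Y x) = mlieBracket I X Y x)
    (hmet : ∀ Y Z : Π y : M, TangentSpace I y, MDiffAt (T% Y) x → MDiffAt (T% Z) x →
      ∀ u : TangentSpace I x, d% (fun y ↦ g y (Y y) (Z y)) x u =
        g x (P Y u) (Z x) + g x (Y x) (P Z u))
    {Y : Π y : M, TangentSpace I y} (hY : MDiffAt (T% Y) x) (u : TangentSpace I x) :
    P Y u = D Y x u := by
  have htor' : ∀ X Y : Π y : M, TangentSpace I y, MDiffAt (T% X) x → MDiffAt (T% Y) x →
      P Y (X x) - D Y x (X x) = P X (Y x) - D X x (Y x) := by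
    intro X Y hX hY
    have h1 := htor X Y hX hY
    have h2 := (CovariantDerivative.torsion_eq_zero_iff D).1 hD.torsion_free hX hY
    rw [← h2] at h1
    exact sub_eq_sub_iff_sub_eq_sub.1 h1
  have hmet' : ∀ Y Z : Π y : M, TangentSpace I y, MDiffAt (T% Y) x → MDiffAt (T% Z) x →
      ∀ u : TangentSpace I x, g x (P Y u - D Y x u) (Z x) = - g x (P Z u - D Z x u) (Y x) := by
    intro Y Z hY hZ u
    have h1 := hmet Y Z hY hZ u
    have h2 := hD.metric x Y Z hY hZ u
    unfold derivMetric at h2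
    rw [map_sub, map_sub]
    have h3 := hg.symm x (Y x) (P Z u)
    have h4 := hg.symm x (Y x) (D Z x u)
    change g x (P Y u) (Z x) - g x (D Y x u) (Z x) = -(g x (P Z u) (Y x) - g x (D Z x u) (Y x))
    linarith
  rw [← sub_eq_zero]
  refine hg.eq_zero fun w ↦ ?_
  have hX := FiberBundle.mdifferentiableAt_extend I E u
  have hZ := FiberBundle.mdifferentiableAt_extend I E w
  have hXx : (FiberBundle.extend E u : Π y : M, TangentSpace I y) x = u :=
    FiberBundle.extend_apply_self E u
  have hZx : (FiberBundle.extend E w : Π y : M, TangentSpace I y) x = w :=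
    FiberBundle.extend_apply_self E w
  generalize (FiberBundle.extend E u : Π y : M, TangentSpace I y) = X at *
  generalize (FiberBundle.extend E w : Π y : M, TangentSpace I y) = Z at *
  subst hXx hZx
  have e1 := hmet' Y Z hY hZ (X x)
  have e2 := hmet' X Y hX hY (Z x)
  have e3 := hmet' Z X hZ hX (Y x)
  rw [htor' X Z hX hZ] at e1
  rw [htor' Z Y hZ hY] at e2
  rw [← htor' X Y hX hY] at e3
  linarith

end Connection

section WarpedAlgebra

variable {E : Type*} [NormedAddCommGroup E] [NormedSpace ℝ E]
  {H : Type*} [TopologicalSpace H] {I : ModelWithCorners ℝ E H}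
  {M : Type*} [TopologicalSpace M] [ChartedSpace H M]

/-- The `ℝ`-component of a vector tangent to `M × ℝ` at `(x, α)`. -/
def verticalPart (x : M) (α : ℝ) (w : TangentSpace (I.prod 𝓘(ℝ, ℝ)) (x, α)) : ℝ :=
  Prod.snd (α := E) (β := ℝ) w

theorem tangentPart_lift (x : M) (α : ℝ) (u : TangentSpace I x) :
    tangentPart x α (lift x α u) = u := rfl

theorem tangentPart_xi (x : M) (α : ℝ) : tangentPart x α (warpedXi I M (x, α)) = 0 := rfl

theorem tangentPart_add (x : M) (α : ℝ) (v w : TangentSpace (I.prod 𝓘(ℝ, ℝ)) (x, α)) :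
    tangentPart x α (v + w) = tangentPart x α v + tangentPart x α w := rfl

theorem tangentPart_sub (x : M) (α : ℝ) (v w : TangentSpace (I.prod 𝓘(ℝ, ℝ)) (x, α)) :
    tangentPart x α (v - w) = tangentPart x α v - tangentPart x α w := rfl

theorem tangentPart_neg (x : M) (α : ℝ) (w : TangentSpace (I.prod 𝓘(ℝ, ℝ)) (x, α)) :
    tangentPart x α (-w) = -tangentPart x α w := rfl

theorem tangentPart_smul (x : M) (α : ℝ) (a : ℝ) (w : TangentSpace (I.prod 𝓘(ℝ, ℝ)) (x, α)) :
    tangentPart x α (a • w) = a • tangentPart x α w := rfl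

theorem eq_lift_add_xi (x : M) (α : ℝ) (w : TangentSpace (I.prod 𝓘(ℝ, ℝ)) (x, α)) :
    w = lift x α (tangentPart x α w) + verticalPart x α w • warpedXi I M (x, α) := by
  have h : ∀ q : E × ℝ, q = (q.1, 0) + q.2 • ((0, 1) : E × ℝ) := fun q ↦ by ext <;> simp
  exact h w

variable (g : BilinField I M)

theorem warpedMetric_lift_right (x : M) (α : ℝ) (w : TangentSpace (I.prod 𝓘(ℝ, ℝ)) (x, α))
    (v : TangentSpace I x) :
    warpedMetric g (x, α) w (lift x α v) = Real.exp (2 * α) * g x (tangentPart x α w) v := by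
  refine (warpedMetric_apply g x α (tangentPart x α w) v (verticalPart x α w) 0).trans ?_
  rw [mul_zero, add_zero]

theorem warpedMetric_lift_left (x : M) (α : ℝ) (w : TangentSpace (I.prod 𝓘(ℝ, ℝ)) (x, α))
    (v : TangentSpace I x) :
    warpedMetric g (x, α) (lift x α v) w = Real.exp (2 * α) * g x v (tangentPart x α w) := by
  refine (warpedMetric_apply g x α v (tangentPart x α w) 0 (verticalPart x α w)).trans ?_
  rw [zero_mul, add_zero]

theorem warpedMetric_xi_right (x : M) (α : ℝ) (w : TangentSpace (I.prod 𝓘(ℝ, ℝ)) (x, α)) :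
    warpedMetric g (x, α) w (warpedXi I M (x, α)) = verticalPart x α w := by
  refine (warpedMetric_apply g x α (tangentPart x α w) 0 (verticalPart x α w) 1).trans ?_
  rw [map_zero, mul_zero, zero_add, mul_one]

theorem verticalPart_lift (x : M) (α : ℝ) (u : TangentSpace I x) :
    verticalPart x α (lift x α u) = 0 := rfl

theorem warpedPhi_lift (J : EndField I M) (x : M) (α : ℝ) (u : TangentSpace I x) :
    warpedPhi J (x, α) (lift x α u) = lift x α (J x u) := rfl

end WarpedAlgebra

section WarpedConnection

open VectorField

variable {E : Type*} [NormedAddCommGroup E] [NormedSpace ℝ E] [FiniteDimensional ℝ E]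
  {H : Type*} [TopologicalSpace H] {I : ModelWithCorners ℝ E H}
  {M : Type*} [TopologicalSpace M] [ChartedSpace H M] [IsManifold I ∞ M]
  {g : BilinField I M} {D₀ : AffineConnection I M}
  {Dbar₀ : AffineConnection (I.prod 𝓘(ℝ, ℝ)) (M × ℝ)} {φ : EndField (I.prod 𝓘(ℝ, ℝ)) (M × ℝ)}

theorem tangentPart_connection_liftField (hg : IsRiemannianMetric g) (hD : IsLeviCivita g D₀)
    (hK : IsKenmotsu (warpedMetric g) Dbar₀ φ (warpedXi I M)) {x : M} (α : ℝ)
    {Y : Π x : M, TangentSpace I x} (hY : MDiffAt (T% Y) x) (u : TangentSpace I x) :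
    tangentPart x α (Dbar₀ (liftField Y) (x, α) (lift x α u)) = D₀ Y x u := by
  refine hD.eq_of_torsion_of_metric hg
    (fun Y u ↦ tangentPart x α (Dbar₀ (liftField Y) (x, α) (lift x α u))) ?_ ?_ hY u
  · intro X Y hX hY
    have h := (CovariantDerivative.torsion_eq_zero_iff Dbar₀).1 hK.levi_civita.torsion_free
      (mdifferentiableAt_liftField (p := (x, α)) hX) (mdifferentiableAt_liftField (p := (x, α)) hY)
    rw [mlieBracket_liftField α hX hY] at h
    exact congrArg (tangentPart x α) h
  · intro Y Z hY hZ u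
    have hY' := mdifferentiableAt_liftField (p := (x, α)) hY
    have hZ' := mdifferentiableAt_liftField (p := (x, α)) hZ
    have h := hK.levi_civita.metric (x, α) _ _ hY' hZ' (lift x α u)
    unfold derivMetric at h
    have h1 := mvfderiv_comp_lift (hK.riemannian.mdifferentiableAt hY' hZ') u
    have h2 : (fun y ↦ warpedMetric g (y, α) (liftField Y (y, α)) (liftField Z (y, α))) =
        fun y ↦ Real.exp (2 * α) * g y (Y y) (Z y) := by
      funext y
      exact warpedMetric_lift_right g y α (lift y α (Y y)) (Z y)
    have h3 : mvfderiv I (fun y ↦ Real.exp (2 * α) * g y (Y y) (Z y)) x u =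
        Real.exp (2 * α) * mvfderiv I (fun y ↦ g y (Y y) (Z y)) x u := by
      have := mvfderiv_mul (f := fun _ : M ↦ Real.exp (2 * α)) (mdifferentiableAt_const (I := I))
        (hg.mdifferentiableAt hY hZ)
      have h4 := congrArg (fun A : E →L[ℝ] ℝ ↦ A u) this
      refine h4.trans ?_
      rw [mvfderiv_const, smul_zero, add_zero]
      rfl
    have h5 := warpedMetric_lift_right g x α (Dbar₀ (liftField Y) (x, α) (lift x α u)) (Z x)
    have h6 := warpedMetric_lift_left g x α (Dbar₀ (liftField Z) (x, α) (lift x α u)) (Y x)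
    have h7 : mvfderiv (I.prod 𝓘(ℝ, ℝ)) (fun p ↦ warpedMetric g p (liftField Y p) (liftField Z p))
        (x, α) (lift x α u) - _ - _ = 0 := h
    erw [h1, h2, h3, h5, h6] at h7
    have := Real.exp_pos (2 * α)
    have h8 : Real.exp (2 * α) * (mvfderiv I (fun y ↦ g y (Y y) (Z y)) x u -
      (g x (tangentPart x α (Dbar₀ (liftField Y) (x, α) (lift x α u))) (Z x) +
        g x (Y x) (tangentPart x α (Dbar₀ (liftField Z) (x, α) (lift x α u))))) = 0 := by
      linarith
    exact sub_eq_zero.1 ((mul_eq_zero.1 h8).resolve_left this.ne')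

theorem tangentPart_connection_xi
    (hK : IsKenmotsu (warpedMetric g) Dbar₀ φ (warpedXi I M)) (x : M) (α : ℝ)
    (u : TangentSpace I x) :
    tangentPart x α (Dbar₀ (warpedXi I M) (x, α) (lift x α u)) = u := by
  rw [hK.deriv_xi, tangentPart_sub, tangentPart_smul, tangentPart_xi, smul_zero, sub_zero,
    tangentPart_lift]

theorem verticalPart_connection_liftField
    (hK : IsKenmotsu (warpedMetric g) Dbar₀ φ (warpedXi I M)) {x : M} (α : ℝ)
    {Y : Π x : M, TangentSpace I x} (hY : MDiffAt (T% Y) x) (u : TangentSpace I x) :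
    verticalPart x α (Dbar₀ (liftField Y) (x, α) (lift x α u)) =
      - (Real.exp (2 * α) * g x (Y x) u) := by
  have hY' := mdifferentiableAt_liftField (p := (x, α)) hY
  have h := hK.levi_civita.metric (x, α) _ _ hY' ((hK.smooth_xi _).mdifferentiableAt (by simp)) (lift x α u)
  unfold derivMetric at h
  have h2 : (fun p : M × ℝ ↦ warpedMetric g p (liftField Y p) (warpedXi I M p)) =
      fun _ ↦ (0 : ℝ) := by
    funext p
    exact warpedMetric_xi_right g p.1 p.2 (lift p.1 p.2 (Y p.1))
  have h3 := warpedMetric_xi_right g x α (Dbar₀ (liftField Y) (x, α) (lift x α u))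
  have h4 := warpedMetric_lift_left g x α (Dbar₀ (warpedXi I M) (x, α) (lift x α u)) (Y x)
  rw [tangentPart_connection_xi hK] at h4
  rw [h2, mvfderiv_const, h3] at h
  have h6 : (0 : ℝ) - _ - _ = 0 := h
  erw [h4] at h6
  linarith

theorem connection_liftField (hg : IsRiemannianMetric g) (hD : IsLeviCivita g D₀)
    (hK : IsKenmotsu (warpedMetric g) Dbar₀ φ (warpedXi I M)) {x : M} (α : ℝ)
    {Y : Π x : M, TangentSpace I x} (hY : MDiffAt (T% Y) x) (u : TangentSpace I x) :
    Dbar₀ (liftField Y) (x, α) (lift x α u) =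
      lift x α (D₀ Y x u) -
        warpedMetric g (x, α) (lift x α (Y x)) (lift x α u) • warpedXi I M (x, α) := by
  refine (eq_lift_add_xi x α _).trans ?_
  rw [tangentPart_connection_liftField hg hD hK α hY, verticalPart_connection_liftField hK α hY,
    warpedMetric_lift_right, neg_smul, sub_eq_add_neg]
  rfl

end WarpedConnection

section WarpedCurvature

open VectorField

variable {E : Type*} [NormedAddCommGroup E] [NormedSpace ℝ E] [FiniteDimensional ℝ E]
  {H : Type*} [TopologicalSpace H] {I : ModelWithCorners ℝ E H}
  {M : Type*} [TopologicalSpace M] [ChartedSpace H M] [IsManifold I ∞ M]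
  {g : BilinField I M} {D₀ : AffineConnection I M}
  {Dbar₀ : AffineConnection (I.prod 𝓘(ℝ, ℝ)) (M × ℝ)} {φ : EndField (I.prod 𝓘(ℝ, ℝ)) (M × ℝ)}

theorem tangentPart_connection_connection [T2Space M] (hg : IsRiemannianMetric g)
    (hD : IsLeviCivita g D₀) (hK : IsKenmotsu (warpedMetric g) Dbar₀ φ (warpedXi I M))
    {x : M} (α : ℝ) (u v w : TangentSpace I x) :
    tangentPart x α (Dbar₀ (fun p ↦ Dbar₀ (FiberBundle.extend (E × ℝ) (lift x α w)) p
      (FiberBundle.extend (E × ℝ) (lift x α v) p)) (x, α) (lift x α u)) =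
    D₀ (fun y ↦ D₀ (FiberBundle.extend E w) y (FiberBundle.extend E v y)) x u -
      (Real.exp (2 * α) * g x w v) • u := by
  have hY := FiberBundle.mdifferentiableAt_extend I E v
  have hZ := FiberBundle.mdifferentiableAt_extend I E w
  have hYx : (FiberBundle.extend E v : Π y : M, TangentSpace I y) x = v :=
    FiberBundle.extend_apply_self E v
  have hZx : (FiberBundle.extend E w : Π y : M, TangentSpace I y) x = w :=
    FiberBundle.extend_apply_self E w
  have hYbar := eventually_extend_lift x α v
  have hZbar := eventually_extend_lift x α w
  obtain ⟨s, hs, hZs⟩ := FiberBundle.exists_contMDiffOn_extend (k := ∞) I E w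
  generalize (FiberBundle.extend E v : Π y : M, TangentSpace I y) = Y at *
  generalize (FiberBundle.extend E w : Π y : M, TangentSpace I y) = Z at *
  generalize (FiberBundle.extend (E × ℝ) (lift x α v) :
    Π p : M × ℝ, TangentSpace (I.prod 𝓘(ℝ, ℝ)) p) = Ybar at *
  generalize (FiberBundle.extend (E × ℝ) (lift x α w) :
    Π p : M × ℝ, TangentSpace (I.prod 𝓘(ℝ, ℝ)) p) = Zbar at *
  subst hYx hZx
  have hW := mdifferentiableAt_connection hD.smooth hs hZs hY
  set W : Π y : M, TangentSpace I y := fun y ↦ D₀ Z y (Y y) 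
  set f : M × ℝ → ℝ := fun p ↦ -(warpedMetric g p (liftField Z p) (liftField Y p)) with hfdef
  have hf : MDiffAt f (x, α) := (hK.riemannian.mdifferentiableAt
    (mdifferentiableAt_liftField (p := (x, α)) hZ)
    (mdifferentiableAt_liftField (p := (x, α)) hY)).neg
  have hxi := (hK.smooth_xi (x, α)).mdifferentiableAt (by simp)
  have hWbar := mdifferentiableAt_liftField (p := (x, α)) hW
  have hF : MDiffAt (T% (liftField W + f • warpedXi I M)) (x, α) :=
    mdifferentiableAt_add_section hWbar (hf.smul_section hxi)
  have hEq : ∀ᶠ p in nhds (x, α),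
      Dbar₀ Zbar p (Ybar p) = (liftField W + f • warpedXi I M) p := by
    have hs' : ∀ᶠ p : M × ℝ in nhds (x, α), p.1 ∈ interior s :=
      continuous_fst.continuousAt (interior_mem_nhds.2 hs)
    filter_upwards [hs', hYbar, hZbar.eventually_nhds] with p hp hpY hpZ
    obtain ⟨y, β⟩ := p
    have hZy : MDiffAt (T% Z) y := (hZs.contMDiffAt
      (mem_interior_iff_mem_nhds.1 hp)).mdifferentiableAt (by simp)
    have hZy' := mdifferentiableAt_liftField (p := (y, β)) hZy
    have hZy'' : MDiffAt (T% Zbar) (y, β) :=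
      hZy'.congr_of_eventuallyEq (hpZ.mono fun q hq ↦ congrArg (Bundle.TotalSpace.mk' (E × ℝ) q) hq)
    rw [Dbar₀.isCovariantDerivativeOn.congr_of_eventuallyEq hZy'' hZy' Filter.univ_mem hpZ, hpY]
    refine (connection_liftField hg hD hK β hZy (Y y)).trans ?_
    rw [sub_eq_add_neg, ← neg_smul]
    rfl
  have hF' : MDiffAt (T% (fun p ↦ Dbar₀ Zbar p (Ybar p))) (x, α) :=
    hF.congr_of_eventuallyEq (hEq.mono fun q hq ↦ congrArg (Bundle.TotalSpace.mk' (E × ℝ) q) hq)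
  rw [Dbar₀.isCovariantDerivativeOn.congr_of_eventuallyEq hF' hF Filter.univ_mem hEq,
    Dbar₀.isCovariantDerivativeOnUniv.add hWbar (hf.smul_section hxi),
    Dbar₀.isCovariantDerivativeOnUniv.leibniz hxi hf]
  have e1 := tangentPart_connection_liftField hg hD hK α hW u
  have e2 := tangentPart_connection_xi hK x α u
  have e3 : f (x, α) = -(Real.exp (2 * α) * g x (Z x) (Y x)) := by
    rw [hfdef]
    exact congrArg Neg.neg (warpedMetric_lift_right g x α (lift x α (Z x)) (Y x))
  change tangentPart x α (Dbar₀ (liftField W) (x, α) (lift x α u)) +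
    (f (x, α) • tangentPart x α (Dbar₀ (warpedXi I M) (x, α) (lift x α u)) +
      mvfderiv (I.prod 𝓘(ℝ, ℝ)) f (x, α) (lift x α u) •
        tangentPart x α (warpedXi I M (x, α))) = _
  rw [e1, e2, e3, tangentPart_xi, smul_zero, add_zero, neg_smul, sub_eq_add_neg]

theorem tangentPart_curvature [T2Space M] (hg : IsRiemannianMetric g)
    (hD : IsLeviCivita g D₀) (hK : IsKenmotsu (warpedMetric g) Dbar₀ φ (warpedXi I M))
    {x : M} (α : ℝ) (u v w : TangentSpace I x) :
    tangentPart x α (curvature Dbar₀ (x, α) (lift x α u) (lift x α v) (lift x α w)) =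
      curvature D₀ x u v w -
        Real.exp (2 * α) • (g x v w • u - g x u w • v) := by
  have h1 := tangentPart_connection_connection hg hD hK α u v w
  have h2 := tangentPart_connection_connection hg hD hK α v u w
  have hX := FiberBundle.mdifferentiableAt_extend I E u
  have hY := FiberBundle.mdifferentiableAt_extend I E v
  have hZ := FiberBundle.mdifferentiableAt_extend I E w
  have hZ' := mdifferentiableAt_liftField (p := (x, α)) hZ
  have h3 : mlieBracket (I.prod 𝓘(ℝ, ℝ)) (FiberBundle.extend (E × ℝ) (lift x α u))
      (FiberBundle.extend (E × ℝ) (lift x α v)) (x, α) =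
      lift x α (mlieBracket I (FiberBundle.extend E u) (FiberBundle.extend E v) x) := by
    rw [← mlieBracket_liftField α hX hY]
    exact Filter.EventuallyEq.mlieBracket_vectorField_eq (eventually_extend_lift x α u)
      (eventually_extend_lift x α v)
  have h4 := tangentPart_connection_liftField hg hD hK α hZ
    (mlieBracket I (FiberBundle.extend E u) (FiberBundle.extend E v) x)
  rw [← h3, ← Dbar₀.isCovariantDerivativeOn.congr_of_eventuallyEq
    (FiberBundle.mdifferentiableAt_extend (I.prod 𝓘(ℝ, ℝ)) (E × ℝ) (lift x α w)) hZ'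
    Filter.univ_mem (eventually_extend_lift x α w)] at h4
  have h5 : ∀ a b c a' b' c' p q : TangentSpace I x, a = a' - p → b = b' - q → c = c' →
      a - b - c = a' - b' - c' - (p - q) := by
    rintro a b c a' b' c' p q rfl rfl rfl
    abel
  refine (h5 _ _ _ _ _ _ _ _ h1 h2 h4).trans ?_
  rw [smul_sub, smul_smul, smul_smul, hg.symm x w v, hg.symm x w u]
  rfl

end WarpedCurvature

section DifferenceTensor

variable {E : Type*} [NormedAddCommGroup E] [NormedSpace ℝ E] [FiniteDimensional ℝ E]
  {H : Type*} [TopologicalSpace H] {I : ModelWithCorners ℝ E H}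
  {M : Type*} [TopologicalSpace M] [ChartedSpace H M] [IsManifold I ∞ M]

theorem diffTensor_apply (D D₀ : AffineConnection I M) {x : M} {Y : Π x : M, TangentSpace I x}
    (hY : MDiffAt (T% Y) x) (u : TangentSpace I x) :
    diffTensor D D₀ x u (Y x) = D Y x u - D₀ Y x u := by
  have h := IsCovariantDerivativeOn.difference_apply D.isCovariantDerivativeOnUniv
    D₀.isCovariantDerivativeOnUniv (x := x) (by trivial) hY
  exact congrArg (fun A : E →L[ℝ] E ↦ A u) h

theorem diffTensor_zero (D D₀ : AffineConnection I M) (x : M) (u : TangentSpace I x) :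
    diffTensor D D₀ x u 0 = 0 := by
  have h := map_zero (D.difference D₀ x)
  exact congrArg (fun A : E →L[ℝ] E ↦ A u) h

theorem diffTensor_symm {D D₀ : AffineConnection I M} (hD : D.torsion = 0) (hD₀ : D₀.torsion = 0)
    (x : M) (u v : TangentSpace I x) : diffTensor D D₀ x u v = diffTensor D D₀ x v u := by
  have hX := FiberBundle.mdifferentiableAt_extend I E u
  have hY := FiberBundle.mdifferentiableAt_extend I E v
  have hXx : (FiberBundle.extend E u : Π y : M, TangentSpace I y) x = u :=
    FiberBundle.extend_apply_self E u
  have hYx : (FiberBundle.extend E v : Π y : M, TangentSpace I y) x = v :=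
    FiberBundle.extend_apply_self E v
  generalize (FiberBundle.extend E u : Π y : M, TangentSpace I y) = X at *
  generalize (FiberBundle.extend E v : Π y : M, TangentSpace I y) = Y at *
  subst hXx hYx
  rw [diffTensor_apply D D₀ hX, diffTensor_apply D D₀ hY]
  have h1 := (CovariantDerivative.torsion_eq_zero_iff D).1 hD hX hY
  have h2 := (CovariantDerivative.torsion_eq_zero_iff D₀).1 hD₀ hX hY
  exact sub_eq_sub_iff_sub_eq_sub.1 (h1.trans h2.symm)

theorem IsStatistical.metric_diffTensor {g : BilinField I M} {D D₀ : AffineConnection I M}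
    (hD : IsStatistical g D) (hD₀ : IsLeviCivita g D₀)
    (x : M) (u v w : TangentSpace I x) :
    g x v (diffTensor D D₀ x u w) = g x u (diffTensor D D₀ x v w) := by
  have hX := FiberBundle.mdifferentiableAt_extend I E u
  have hY := FiberBundle.mdifferentiableAt_extend I E v
  have hZ := FiberBundle.mdifferentiableAt_extend I E w
  have hXx : (FiberBundle.extend E u : Π y : M, TangentSpace I y) x = u :=
    FiberBundle.extend_apply_self E u
  have hYx : (FiberBundle.extend E v : Π y : M, TangentSpace I y) x = v :=
    FiberBundle.extend_apply_self E v
  have hZx : (FiberBundle.extend E w : Π y : M, TangentSpace I y) x = w :=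
    FiberBundle.extend_apply_self E w
  have hsymm := diffTensor_symm hD.torsion_free hD₀.torsion_free x u v
  generalize (FiberBundle.extend E u : Π y : M, TangentSpace I y) = X at *
  generalize (FiberBundle.extend E v : Π y : M, TangentSpace I y) = Y at *
  generalize (FiberBundle.extend E w : Π y : M, TangentSpace I y) = Z at *
  subst hXx hYx hZx
  have h0 := hD.codazzi x X Y Z hX hY hZ
  have h1 := hD₀.metric x Y Z hY hZ (X x)
  have h2 := hD₀.metric x X Z hX hZ (Y x)
  rw [diffTensor_apply D D₀ hX, diffTensor_apply D D₀ hY] at hsymm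
  have h3 := congrArg (fun a ↦ g x a (Z x)) hsymm
  have h4 : g x (D Y x (X x)) (Z x) - g x (D₀ Y x (X x)) (Z x) =
      g x (D X x (Y x)) (Z x) - g x (D₀ X x (Y x)) (Z x) := by
    simp only [map_sub] at h3
    exact h3
  rw [diffTensor_apply D D₀ hZ, diffTensor_apply D D₀ hZ, map_sub, map_sub]
  unfold derivMetric at h0 h1 h2
  linarith

end DifferenceTensor

section Warped

variable {E : Type*} [NormedAddCommGroup E] [NormedSpace ℝ E] [FiniteDimensional ℝ E]
  {H : Type*} [TopologicalSpace H] {I : ModelWithCorners ℝ E H}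
  {M : Type*} [TopologicalSpace M] [ChartedSpace H M] [IsManifold I ∞ M]
  {g : BilinField I M} {J : EndField I M} {D D₀ : AffineConnection I M}
  {Dbar Dbar₀ : AffineConnection (I.prod 𝓘(ℝ, ℝ)) (M × ℝ)}

theorem tangentPart_diffTensor_xi (hB : IsKenmotsuStatistical (warpedMetric g) Dbar Dbar₀
      (warpedPhi J) (warpedXi I M)) (x : M) (α : ℝ) (u : TangentSpace (I.prod 𝓘(ℝ, ℝ)) (x, α)) :
    tangentPart x α (diffTensor Dbar Dbar₀ (x, α) u (warpedXi I M (x, α))) = 0 := by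
  have h1 := hB.anti (x, α) u (warpedXi I M (x, α))
  rw [hB.kenmotsu.phi_xi, diffTensor_zero, zero_eq_neg] at h1
  have h2 := hB.kenmotsu.phi_sq (x, α) (diffTensor Dbar Dbar₀ (x, α) u (warpedXi I M (x, α)))
  rw [h1, map_zero] at h2
  have h3 := congrArg (tangentPart x α) h2
  rw [tangentPart_add, tangentPart_neg, tangentPart_smul, tangentPart_xi, smul_zero,
    add_zero] at h3
  exact zero_eq_neg.1 h3

theorem diffTensor_lift (hB : IsKenmotsuStatistical (warpedMetric g) Dbar Dbar₀
      (warpedPhi J) (warpedXi I M)) (x : M) (α : ℝ) (u v : TangentSpace I x) :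
    diffTensor Dbar Dbar₀ (x, α) (lift x α u) (lift x α v) =
      lift x α (tangentPart x α
        (diffTensor Dbar Dbar₀ (x, α) (lift x α u) (lift x α v))) := by
  have h1 := hB.statistical.metric_diffTensor hB.kenmotsu.levi_civita (x, α)
    (lift x α u) (warpedXi I M (x, α)) (lift x α v)
  rw [diffTensor_symm hB.statistical.torsion_free hB.kenmotsu.levi_civita.torsion_free (x, α)
    (warpedXi I M (x, α)), warpedMetric_lift_left, tangentPart_diffTensor_xi hB, map_zero, mul_zero,
    hB.kenmotsu.riemannian.symm, warpedMetric_xi_right] at h1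
  have h2 := eq_lift_add_xi x α (diffTensor Dbar Dbar₀ (x, α) (lift x α u) (lift x α v))
  rw [h1, zero_smul, add_zero] at h2
  exact h2

theorem tangentPart_statCurvature [T2Space M] (hg : IsRiemannianMetric g)
    (hD₀ : IsLeviCivita g D₀)
    (hB : IsKenmotsuStatistical (warpedMetric g) Dbar Dbar₀ (warpedPhi J) (warpedXi I M))
    {x : M} {α : ℝ}
    (hα : ∀ u v : TangentSpace I x, tangentPart x α (diffTensor Dbar Dbar₀ (x, α)
      (lift x α u) (lift x α v)) = diffTensor D D₀ x u v) (u v w : TangentSpace I x) :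
    tangentPart x α (statCurvature Dbar Dbar₀ (x, α) (lift x α u) (lift x α v) (lift x α w)) =
      statCurvature D D₀ x u v w - Real.exp (2 * α) • (g x v w • u - g x u w • v) := by
  have h1 : ∀ u v : TangentSpace I x, diffTensor Dbar Dbar₀ (x, α) (lift x α u) (lift x α v) =
      lift x α (diffTensor D D₀ x u v) := by
    intro u v
    rw [diffTensor_lift hB, hα]
  unfold statCurvature
  rw [tangentPart_sub, tangentPart_add, tangentPart_curvature hg hD₀ hB.kenmotsu, h1, h1, h1, h1,
    tangentPart_lift, tangentPart_lift]
  abel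

theorem statCurvature_eq [T2Space M] (hM : IsKaehler g D₀ J)
    (hB : IsKenmotsuStatistical (warpedMetric g) Dbar Dbar₀ (warpedPhi J) (warpedXi I M))
    {c : ℝ} (hc : HasConstantPhiCurvature (warpedMetric g) Dbar Dbar₀ (warpedPhi J)
      (warpedXi I M) c)
    {x : M} {α : ℝ}
    (hα : ∀ u v : TangentSpace I x, tangentPart x α (diffTensor Dbar Dbar₀ (x, α)
      (lift x α u) (lift x α v)) = diffTensor D D₀ x u v) (u v w : TangentSpace I x) :
    statCurvature D D₀ x u v w = (Real.exp (2 * α) * ((c + 1) / 4)) •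
      (g x v w • u - g x u w • v + g x (J x v) w • J x u - g x (J x u) w • J x v
        - (2 * g x (J x u) v) • J x w) := by
  have h1 := tangentPart_statCurvature hM.riemannian hM.levi_civita hB hα u v w
  rw [hc] at h1
  simp only [tangentPart_add, tangentPart_sub, tangentPart_smul, tangentPart_lift, tangentPart_xi,
    warpedPhi_lift, warpedMetric_lift_left, warpedMetric_xi_right, verticalPart_lift] at h1
  refine (sub_eq_iff_eq_add.1 h1.symm).trans ?_
  module

end Warped

section Trace

theorem sum_repr_eq_zero_of_skew {V : Type*} [AddCommGroup V] [Module ℝ V] {ι : Type*} [Fintype ι]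
    (b : Module.Basis ι ℝ V) (B : V →ₗ[ℝ] V →ₗ[ℝ] ℝ) (hB : ∀ u, (∀ v, B u v = 0) → u = 0)
    (J : V →ₗ[ℝ] V) (hJ : ∀ u v, B (J u) v = -B u (J v)) :
    ∑ i, b.repr (J (b i)) i = 0 := by
  classical
  have : FiniteDimensional ℝ V := Module.Finite.of_basis b
  have htr : ∑ i, b.repr (J (b i)) i = LinearMap.trace ℝ V J := by
    rw [LinearMap.trace_eq_matrix_trace ℝ b, Matrix.trace]
    simp [LinearMap.toMatrix_apply]
  have hinj : Function.Injective B := (injective_iff_map_eq_zero B).2 fun u hu ↦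
    hB u fun v ↦ by rw [hu]; rfl
  let e : V ≃ₗ[ℝ] Module.Dual ℝ V :=
    LinearEquiv.ofInjectiveOfFinrankEq B hinj Subspace.dual_finrank_eq.symm
  have hconj : e.conj J = (-1 : ℝ) • Module.Dual.transpose (R := ℝ) J := by
    ext f v
    obtain ⟨u, rfl⟩ := e.surjective f
    have : e (J u) v = -e u (J v) := hJ u v
    change e (J (e.symm (e u))) v = (-1 : ℝ) * e u (J v)
    rw [e.symm_apply_apply, this, neg_one_mul]
  have h1 := LinearMap.trace_conj' J e
  rw [hconj, map_smul, LinearMap.trace_transpose', smul_eq_mul] at h1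
  linarith

theorem sum_repr_mul_apply {V : Type*} [AddCommGroup V] [Module ℝ V] {ι : Type*} [Fintype ι]
    (b : Module.Basis ι ℝ V) (f : V →ₗ[ℝ] ℝ) (v : V) : ∑ i, f (b i) * b.repr v i = f v := by
  conv_rhs => rw [← b.sum_repr v, map_sum]
  simp only [map_smul, smul_eq_mul, mul_comm]

/-- The trace of the curvature tensor of constant holomorphic sectional curvature `4`. -/
theorem sum_repr_holomorphicCurvature {V : Type*} [AddCommGroup V] [Module ℝ V] {ι : Type*}
    [Fintype ι] (b : Module.Basis ι ℝ V) (B : V →ₗ[ℝ] V →ₗ[ℝ] ℝ)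
    (hB : ∀ u, (∀ v, B u v = 0) → u = 0) (hsymm : ∀ u v, B u v = B v u) (J : V →ₗ[ℝ] V)
    (hJ : ∀ u, J (J u) = -u) (hBJ : ∀ u v, B (J u) (J v) = B u v) (v w : V) :
    ∑ i, b.repr (B v w • b i - B (b i) w • v + B (J v) w • J (b i) - B (J (b i)) w • J v
        - (2 * B (J (b i)) v) • J w) i = (Fintype.card ι + 2) * B v w := by
  have hskew : ∀ u v, B (J u) v = -B u (J v) := fun u v ↦ by
    rw [← hBJ u (J v), hJ, map_neg, neg_neg]
  have h1 := sum_repr_mul_apply b (B.flip w) v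
  have h2 := sum_repr_eq_zero_of_skew b B hB J hskew
  have h3 := sum_repr_mul_apply b ((B.flip w).comp J) (J v)
  have h4 := sum_repr_mul_apply b ((B.flip v).comp J) (J w)
  simp only [LinearMap.flip_apply, LinearMap.comp_apply, hJ, map_neg, hsymm w v] at h1 h3 h4
  simp only [map_add, map_sub, map_smul, Finsupp.add_apply, Finsupp.sub_apply, Finsupp.smul_apply,
    smul_eq_mul, Finset.sum_add_distrib, Finset.sum_sub_distrib, ← Finset.mul_sum, mul_assoc,
    Module.Basis.repr_self, Finsupp.single_eq_same, h1, h2, h3, h4]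
  simp
  ring

end Trace

end KenmotsuStat

end

theorem proposition3p10
    {E : Type*} [NormedAddCommGroup E] [NormedSpace ℝ E] [FiniteDimensional ℝ E]
    {H : Type*} [TopologicalSpace H] (I : ModelWithCorners ℝ E H)
    {M : Type*} [TopologicalSpace M] [ChartedSpace H M] [IsManifold I ∞ M]
    [BoundarylessManifold I M] [T2Space M] [SecondCountableTopology M]
    (s : ℕ) (hdim : Module.finrank ℝ E = 2 * s)
    -- the holomorphic statistical manifold `(M, D, g, J)`, `D₀` the Levi-Civita connection of `g`
    (g : KenmotsuStat.BilinField I M) (J : KenmotsuStat.EndField I M)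
    (D D₀ : KenmotsuStat.AffineConnection I M)
    (hM : KenmotsuStat.IsHolomorphicStatistical g D D₀ J)
    -- the Kenmotsu statistical structure on the warped product `M × ℝ`
    (Dbar Dbar₀ : KenmotsuStat.AffineConnection (I.prod 𝓘(ℝ, ℝ)) (M × ℝ))
    (hB : KenmotsuStat.IsKenmotsuStatistical (KenmotsuStat.warpedMetric g) Dbar Dbar₀
      (KenmotsuStat.warpedPhi J) (KenmotsuStat.warpedXi I M))
    (c : ℝ)
    (hc : KenmotsuStat.HasConstantPhiCurvature (KenmotsuStat.warpedMetric g) Dbar Dbar₀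
      (KenmotsuStat.warpedPhi J) (KenmotsuStat.warpedXi I M) c)
    -- along the slice `M × {α}`, the component tangent to `M` of the difference tensor of `M × ℝ`
    -- is the difference tensor of `M`
    (α : ℝ)
    (hα : ∀ (x : M) (u v : TangentSpace I x),
      KenmotsuStat.tangentPart x α (KenmotsuStat.diffTensor Dbar Dbar₀ (x, α)
        (KenmotsuStat.lift x α u) (KenmotsuStat.lift x α v)) =
      KenmotsuStat.diffTensor D D₀ x u v) :
    (∀ (x : M) (v w : TangentSpace I x),
      KenmotsuStat.ricci D D₀ x v w =
        Real.exp (2 * α) * ((c + 1) * ((s : ℝ) + 1) / 2) * g x v w) ∧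
    (c = -1 → KenmotsuStat.IsRicciFlat D D₀) := by
  have main : ∀ (x : M) (v w : TangentSpace I x), KenmotsuStat.ricci D D₀ x v w =
      Real.exp (2 * α) * ((c + 1) * ((s : ℝ) + 1) / 2) * g x v w := by
    intro x v w
    have hK := hM.kaehler
    let b : Module.Basis (Fin (Module.finrank ℝ E)) ℝ (TangentSpace I x) := Module.finBasis ℝ E
    let B : TangentSpace I x →ₗ[ℝ] TangentSpace I x →ₗ[ℝ] ℝ :=
      LinearMap.mk₂ ℝ (fun u v ↦ g x u v) (by simp) (by simp) (by simp) (by simp)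
    have h := KenmotsuStat.sum_repr_holomorphicCurvature b B
      (fun u hu ↦ hK.riemannian.eq_zero hu) (hK.riemannian.symm x) (J x : _ →ₗ[ℝ] _) (hK.sq x)
      (hK.hermitian x) v w
    have hcard : (Fintype.card (Fin (Module.finrank ℝ E)) : ℝ) = 2 * s := by
      rw [Fintype.card_fin, hdim, Nat.cast_mul, Nat.cast_ofNat]
    have h1 : KenmotsuStat.ricci D D₀ x v w =
        ∑ i, b.repr (KenmotsuStat.statCurvature D D₀ x (b i) v w) i := rfl
    rw [h1]
    simp only [KenmotsuStat.statCurvature_eq hK hB hc (hα x), map_smul, Finsupp.smul_apply,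
      smul_eq_mul, ← Finset.mul_sum]
    refine (congrArg (Real.exp (2 * α) * ((c + 1) / 4) * ·) h).trans ?_
    change _ * (((Fintype.card (Fin (Module.finrank ℝ E)) : ℝ) + 2) * g x v w) = _
    rw [hcard]
    ring
  refine ⟨main, fun hc1 x v w ↦ ?_⟩
  rw [main, hc1]
  ring
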